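/- Let $n\geq 1$, let $\mathfrak T_n$ be the monoid of all self-maps of $\{1,\dots,n\}$ under composition, and let $\mathbb C^n$ be the natural $\mathbb C\mathfrak T_n$-module, with standard basis $v_1,\dots,v_n$ and action $fv_i=v_{f(i)}$. Let $V=\mathrm{Aug}(\mathbb C^n)$ be the submodule of vectors whose coordinates sum to $0$. Exterior powers (over $\mathbb C$) carry the diagonal action of $\mathfrak T_n$. Put $w_i=v_i-v_n$ for $1\leq i\leq n-1$ and $w_n=v_1+\cdots+v_n$; then $w_1,\dots,w_n$ is a basis of $\mathbb C^n$. A projective resolution is called minimal if each of its maps, including the augmentation, is a projective cover of its image. For $1\leq r\leq n$, the module $\Lambda^{r-1}(V)$ is simple, and its minimal projective resolution is \[0\to P_{n-r}\xrightarrow{d_{n-r}}\cdots\xrightarrow{d_1}P_0\xrightarrow{d_0}\Lambda^{r-1}(V)\to 0,\] where $P_q=\Lambda^{q+r}(\mathbb C^n)$ and, for $1\leq i_1<\cdots<i_{q+r}\leq n$, \[d_q(w_{i_1}\wedge\cdots\wedge w_{i_{q+r}})=\begin{cases} w_{i_1}\wedge\cdots\wedge w_{i_{q+r-1}}, & \text{if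 } i_{q+r}=n,\\ 0, & \text{otherwise.}\end{cases}\] Consequently the projective dimension of $\Lambda^{r-1}(V)$ over $\mathbb C\mathfrak T_n$ is $n-r$ for $1\leq r\leq n$. In particular, the projective dimension of the trivial $\mathbb C\mathfrak T_n$-module is $n-1$. -/

import Mathlib

/-! ### Minimal projective resolutions over a ring -/

namespace TransfMonoid

section Resolution

universe u v w

variable {A : Type u} [Ring A]

/-- A linear map `f : P → M` is a projective cover if `P` is projective, `f` is surjective and the
kernel of `f` is superfluous: the only submodule `N` of `P` with `ker f + N = P` is `P` itself. -/
structure IsProjectiveCover {P : Type v} {M : Type w} [AddCommGroup P] [Module A P]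
    [AddCommGroup M] [Module A M] (f : P →ₗ[A] M) : Prop where
  projective : Module.Projective A P
  surjective : Function.Surjective f
  superfluous : ∀ N : Submodule A P, LinearMap.ker f ⊔ N = ⊤ → N = ⊤

variable {P : ℕ → Type v} [∀ q, AddCommGroup (P q)] [∀ q, Module A (P q)]
  {M : Type w} [AddCommGroup M] [Module A M]

/-- The sequence `⋯ → P 2 → P 1 → P 0 → M → 0`, with maps `d q : P (q + 1) → P q` and
`ε : P 0 → M`, is a projective resolution of `M`. -/
structure IsProjectiveResolution (d : ∀ q, P (q + 1) →ₗ[A] P q) (ε : P 0 →ₗ[A] M) : Prop where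
  projective : ∀ q, Module.Projective A (P q)
  surjective : Function.Surjective ε
  exact_zero : Function.Exact (d 0) ε
  exact_succ : ∀ q, Function.Exact (d (q + 1)) (d q)

/-- A projective resolution is minimal if each of its maps (including the augmentation) is a
projective cover of its image. -/
structure IsMinimalProjectiveResolution (d : ∀ q, P (q + 1) →ₗ[A] P q) (ε : P 0 →ₗ[A] M) : Prop
    extends IsProjectiveResolution d ε where
  cover_zero : IsProjectiveCover ε.rangeRestrict
  cover_succ : ∀ q, IsProjectiveCover (d q).rangeRestrict

end Resolution

/-! ### Exterior powers of a representation -/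

section ExteriorPower

variable {k G V : Type*} [CommRing k] [Monoid G] [AddCommGroup V] [Module k V]

/-- The exterior power `⋀^m V` of a representation of a monoid, with the diagonal action
`g (x₁ ∧ ⋯ ∧ xₘ) = g x₁ ∧ ⋯ ∧ g xₘ`. -/
noncomputable def exteriorRep (ρ : Representation k G V) (m : ℕ) :
    Representation k G (⋀[k]^m V) where
  toFun g := exteriorPower.map m (ρ g)
  map_one' := by
    rw [map_one]
    exact exteriorPower.map_id
  map_mul' g h := by
    rw [map_mul]
    exact exteriorPower.map_comp (ρ h) (ρ g)

theorem exteriorRep_ιMulti (ρ : Representation k G V) (m : ℕ) (g : G) (x : Fin m → V) :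
    exteriorRep ρ m g (exteriorPower.ιMulti k m x) =
      exteriorPower.ιMulti k m fun j => ρ g (x j) :=
  exteriorPower.map_apply_ιMulti (ρ g) x

/-- The exterior power of a representation as a module over the monoid algebra. -/
abbrev ExtPow (ρ : Representation k G V) (m : ℕ) : Type _ := (exteriorRep ρ m).asModule

/-- The wedge product `x₁ ∧ ⋯ ∧ xₘ` as an element of the module `⋀^m V`. -/
noncomputable def wedge (ρ : Representation k G V) {m : ℕ} (x : Fin m → V) : ExtPow ρ m :=
  (exteriorRep ρ m).asModuleEquiv.symm (exteriorPower.ιMulti k m x)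

end ExteriorPower

/-! ### The full transformation monoid, the natural module and the augmentation -/

/-- The full transformation monoid: all self-maps of `{1, …, n}` under composition
(`f * g = f ∘ g`). -/
abbrev FullTransf (n : ℕ) : Type := Function.End (Fin n)

/-- The complex monoid algebra of the full transformation monoid. -/
abbrev TransfAlg (n : ℕ) : Type := MonoidAlgebra ℂ (FullTransf n)

/-- The standard basis vector `v_i` of `ℂⁿ`. -/
def v {n : ℕ} (i : Fin n) : Fin n → ℂ := Pi.single i 1

/-- The linear endomorphism of `ℂⁿ` with `v_i ↦ v_{f i}`. -/
noncomputable def naturalMap {n : ℕ} (f : FullTransf n) : (Fin n → ℂ) →ₗ[ℂ] (Fin n → ℂ) :=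
  (Pi.basisFun ℂ (Fin n)).constr ℂ fun i => v (f i)

theorem naturalMap_v {n : ℕ} (f : FullTransf n) (i : Fin n) : naturalMap f (v i) = v (f i) := by
  have h := (Pi.basisFun ℂ (Fin n)).constr_basis ℂ (fun i => v (f i)) i
  rwa [Pi.basisFun_apply] at h

theorem linearMap_ext_v {n : ℕ} {W : Type*} [AddCommGroup W] [Module ℂ W]
    {f g : (Fin n → ℂ) →ₗ[ℂ] W} (h : ∀ i, f (v i) = g (v i)) : f = g := by
  refine (Pi.basisFun ℂ (Fin n)).ext fun i => ?_
  rw [Pi.basisFun_apply]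
  exact h i

/-- The natural module `ℂⁿ`, on which a self-map `f` acts by `f v_i = v_{f i}`. -/
noncomputable def naturalRep (n : ℕ) : Representation ℂ (FullTransf n) (Fin n → ℂ) where
  toFun := naturalMap
  map_one' := linearMap_ext_v fun i => naturalMap_v 1 i
  map_mul' f g := linearMap_ext_v fun i => by
    rw [Module.End.mul_apply, naturalMap_v, naturalMap_v, naturalMap_v]
    rfl

/-- The augmentation `Aug(ℂⁿ)`: vectors whose coordinates sum to zero. -/
def aug (n : ℕ) : Submodule ℂ (Fin n → ℂ) where
  carrier := {x | ∑ i, x i = 0}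
  add_mem' {x y} hx hy := by
    simp only [Set.mem_ofPred_eq] at hx hy ⊢
    simp [Finset.sum_add_distrib, hx, hy]
  zero_mem' := by simp
  smul_mem' c x hx := by
    simp only [Set.mem_ofPred_eq] at hx ⊢
    simp [← Finset.mul_sum, hx]

theorem sum_v {n : ℕ} (i : Fin n) : ∑ j, v i j = 1 := by
  simp [v]

theorem sum_naturalMap {n : ℕ} (f : FullTransf n) (x : Fin n → ℂ) :
    ∑ j, naturalMap f x j = ∑ j, x j := by
  have h : (∑ j, LinearMap.proj j : (Fin n → ℂ) →ₗ[ℂ] ℂ) ∘ₗ naturalMap f =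
      ∑ j, LinearMap.proj j :=
    linearMap_ext_v fun i => by
      simp [naturalMap_v, sum_v]
  simpa using LinearMap.congr_fun h x

/-- `Aug(ℂⁿ)` as a submodule of the natural module. -/
noncomputable def augRep (n : ℕ) : Representation ℂ (FullTransf n) (aug n) :=
  (naturalRep n).subrepresentation (aug n) fun f x hx => (sum_naturalMap f x).trans hx

/-- The trivial module `ℂ`. -/
abbrev TrivialModule (n : ℕ) : Type := (Representation.trivial ℂ (FullTransf n) ℂ).asModule

/-! ### The basis `w₁, …, wₙ` -/

/-- The last index `n`, available as soon as there is some index. -/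
def lastOf {n : ℕ} (i : Fin n) : Fin n := ⟨n - 1, Nat.sub_one_lt_of_lt i.isLt⟩

/-- The differences `v_i - v_n`, as vectors of `Aug(ℂⁿ)`. -/
def augW {n : ℕ} (i : Fin n) : aug n :=
  ⟨v i - v (lastOf i), by
    change ∑ j, (v i - v (lastOf i)) j = 0
    simp [Finset.sum_sub_distrib, sum_v]⟩

/-- The vectors `w_i = v_i - v_n` for `i < n` and `w_n = v_1 + ⋯ + v_n`. -/
def w {n : ℕ} (i : Fin n) : Fin n → ℂ :=
  if i = lastOf i then ∑ j, v j else v i - v (lastOf i)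

end TransfMonoid

/-! The differential is contraction of the last factor by the mean `mean n`. Self-maps preserve
coordinate sums, so this form is invariant and contraction is equivariant. It takes the value 1 on
`w_n` and 0 on the other `w_i`, which gives the formula for `d_q`.

Exactness is that of a Koszul complex: if σ(u) = 1, then x ↦ x ∧ u is a contracting homotopy. The
kernel of contraction on Λ^m(ℂⁿ) is Λ^m(Aug), by projecting along u = v_1 + ⋯ + v_n
(`map_subtype_map_augProj`).

In positive degree Λ^m(ℂⁿ) is a summand of the regular module, split by antisymmetrization
(`projective_extPow`). Minimality and simplicity rest on self-maps with few values. An idempotent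
with image {i_0, …, i_m} fixes the wedge of the v_{i_j} and kills the kernel of contraction
(`exists_fix_and_kill`). For simplicity, a map with at most m + 1 values moves a suitable element
onto the line of one wedge, and that wedge generates everything.

The projective dimension follows by dimension shifting along 0 → Λ^{m+1}(Aug) → Λ^{m+1}(ℂⁿ) →
Λ^m(Aug) → 0. -/

namespace ExteriorAlgebra

/-! ### Right contraction on the exterior algebra -/

variable {R M N : Type*} [CommRing R] [AddCommGroup M] [Module R M] [AddCommGroup N] [Module R N]

/-- Contraction of the exterior algebra from the right by a linear form. -/
noncomputable def rightContract (σ : Module.Dual R M) :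
    ExteriorAlgebra R M →ₗ[R] ExteriorAlgebra R M :=
  (CliffordAlgebra.contractRight (Q := (0 : QuadraticForm R M))).flip σ

variable (σ : Module.Dual R M)

theorem rightContract_mul_ι (x : ExteriorAlgebra R M) (a : M) :
    rightContract σ (x * ι R a) = σ a • x - rightContract σ x * ι R a :=
  CliffordAlgebra.contractRight_mul_ι σ a x

@[simp]
theorem rightContract_algebraMap (r : R) :
    rightContract σ (algebraMap R (ExteriorAlgebra R M) r) = 0 :=
  CliffordAlgebra.contractRight_algebraMap 0 σ r

@[simp]
theorem rightContract_one : rightContract σ (1 : ExteriorAlgebra R M) = 0 :=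
  CliffordAlgebra.contractRight_one 0 σ

theorem rightContract_rightContract (x : ExteriorAlgebra R M) :
    rightContract σ (rightContract σ x) = 0 :=
  CliffordAlgebra.contractRight_contractRight (Q := (0 : QuadraticForm R M)) σ x

theorem right_induction {C : ExteriorAlgebra R M → Prop}
    (algebraMap : ∀ r, C (algebraMap R (ExteriorAlgebra R M) r))
    (add : ∀ x y, C x → C y → C (x + y))
    (mul_ι : ∀ x a, C x → C (x * ι R a)) (x : ExteriorAlgebra R M) : C x :=
  CliffordAlgebra.right_induction (Q := (0 : QuadraticForm R M)) algebraMap add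
    (fun a x h => mul_ι x a h) x

theorem rightContract_map (f : M →ₗ[R] N) (τ : Module.Dual R N) (x : ExteriorAlgebra R M) :
    rightContract τ (map f x) = map f (rightContract (τ ∘ₗ f) x) := by
  induction x using right_induction with
  | algebraMap r => simp
  | add x y hx hy => simp [hx, hy]
  | mul_ι x a hx => simp [rightContract_mul_ι, hx]

/-- The map `x ↦ x - σ x • u` (the projection onto `ker σ` along `u` if `σ u = 1`) differs from the
identity, on the exterior algebra, by contraction with `σ` followed by multiplication with `u`. -/
theorem map_sub_smulRight (u : M) (x : ExteriorAlgebra R M) :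
    map (LinearMap.id - σ.smulRight u) x = x - rightContract σ x * ι R u := by
  induction x using right_induction with
  | algebraMap r => simp
  | add x y hx hy => rw [map_add, hx, hy, map_add, add_mul, sub_add_sub_comm]
  | mul_ι x a hx =>
    -- Moving a past u yields the sign in the Leibniz rule for contraction; u ∧ u = 0 removes the
    -- cross term.
    have hswap : ι R a * ι R u = -(ι R u * ι R a) := eq_neg_of_add_eq_zero_left (ι_add_mul_swap a u)
    have hsq : ι R u * ι R u = 0 := ι_sq_zero u
    simp only [map_mul, hx, map_apply_ι, rightContract_mul_ι, LinearMap.sub_apply,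
      LinearMap.id_apply, LinearMap.smulRight_apply, map_sub, map_smul, sub_mul, mul_sub,
      mul_smul_comm, smul_mul_assoc, mul_assoc, hswap, hsq, mul_zero, sub_zero, mul_neg]
    abel

theorem ιMulti_succ_last (m : ℕ) (x : Fin (m + 1) → M) :
    ιMulti R (m + 1) x = ιMulti R m (fun j => x j.castSucc) * ι R (x (Fin.last m)) := by
  rw [ιMulti_apply, ιMulti_apply, List.ofFn_succ', List.concat_eq_append, List.prod_append,
    List.prod_singleton]

theorem mul_ι_mem {m : ℕ} {x : ExteriorAlgebra R M} (hx : x ∈ ⋀[R]^m M) (a : M) :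
    x * ι R a ∈ ⋀[R]^(m + 1) M := by
  rw [exteriorPower, pow_succ]
  exact Submodule.mul_mem_mul hx (LinearMap.mem_range_self _ a)

theorem rightContract_mem {m : ℕ} {x : ExteriorAlgebra R M} (hx : x ∈ ⋀[R]^(m + 1) M) :
    rightContract σ x ∈ ⋀[R]^m M := by
  rw [← ιMulti_span_fixedDegree] at hx
  induction hx using Submodule.span_induction with
  | zero => simp
  | add x y _ _ hx hy => rw [map_add]; exact add_mem hx hy
  | smul c x _ hx => rw [map_smul]; exact Submodule.smul_mem _ c hx
  | mem x hx =>
    obtain ⟨y, rfl⟩ := hx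
    induction m with
    | zero =>
      rw [ιMulti_succ_last, rightContract_mul_ι, ιMulti_zero_apply, rightContract_one, zero_mul,
        sub_zero]
      exact Submodule.smul_mem _ _ (by simp [exteriorPower])
    | succ m ih =>
      rw [ιMulti_succ_last, rightContract_mul_ι]
      exact sub_mem (Submodule.smul_mem _ _ (exteriorPower.ιMulti R (m + 1) _).2)
        (mul_ι_mem (ih _) _)

theorem rightContract_ιMulti_eq_zero {m : ℕ} (x : Fin m → M) (hx : ∀ j, σ (x j) = 0) :
    rightContract σ (ιMulti R m x) = 0 := by
  induction m with
  | zero => rw [ιMulti_zero_apply, rightContract_one]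
  | succ m ih => rw [ιMulti_succ_last, rightContract_mul_ι, hx, ih _ fun j => hx _]; simp

end ExteriorAlgebra

/-! ### Contraction and wedge multiplication in fixed degree -/

namespace exteriorPower

open ExteriorAlgebra (rightContract)

variable {R M N : Type*} [CommRing R] [AddCommGroup M] [Module R M] [AddCommGroup N] [Module R N]

theorem coe_map {m : ℕ} (f : M →ₗ[R] N) (x : ⋀[R]^m M) :
    (map m f x : ExteriorAlgebra R N) = ExteriorAlgebra.map f (x : ExteriorAlgebra R M) := by
  have h : (⋀[R]^m N).subtype ∘ₗ map m f =
      (ExteriorAlgebra.map f).toLinearMap ∘ₗ (⋀[R]^m M).subtype := by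
    ext x
    simp
  exact LinearMap.congr_fun h x

/-- Contraction of the last factor of an exterior power by a linear form. -/
noncomputable def contract (m : ℕ) (σ : Module.Dual R M) : ⋀[R]^(m + 1) M →ₗ[R] ⋀[R]^m M :=
  (rightContract σ).restrict fun _ hx => ExteriorAlgebra.rightContract_mem σ hx

/-- Wedge multiplication by a vector on the right. -/
noncomputable def wedgeRight (m : ℕ) (u : M) : ⋀[R]^m M →ₗ[R] ⋀[R]^(m + 1) M :=
  (LinearMap.mulRight R (ExteriorAlgebra.ι R u)).restrict fun _ hx =>
    ExteriorAlgebra.mul_ι_mem hx u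

variable {m : ℕ} (σ : Module.Dual R M)

theorem coe_contract (x : ⋀[R]^(m + 1) M) :
    (contract m σ x : ExteriorAlgebra R M) = rightContract σ (x : ExteriorAlgebra R M) := rfl

theorem coe_wedgeRight (u : M) (x : ⋀[R]^m M) :
    (wedgeRight m u x : ExteriorAlgebra R M) = x * ExteriorAlgebra.ι R u := rfl

theorem contract_contract (x : ⋀[R]^(m + 2) M) : contract m σ (contract (m + 1) σ x) = 0 :=
  Subtype.ext (ExteriorAlgebra.rightContract_rightContract σ _)

theorem contract_map (f : M →ₗ[R] N) (τ : Module.Dual R N) (x : ⋀[R]^(m + 1) M) :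
    contract m τ (map (m + 1) f x) = map m f (contract m (τ ∘ₗ f) x) := by
  ext
  simp only [coe_contract, coe_map, ExteriorAlgebra.rightContract_map]

/-- The contracting homotopy: contracting x ∧ u gives σ(u) x minus (contraction of x) ∧ u. The
hypothesis is stated in the full exterior algebra so that degree 0 is included. -/
theorem contract_wedgeRight_of_contract_eq_zero (u : M) (hu : σ u = 1) (x : ⋀[R]^m M)
    (hx : rightContract σ (x : ExteriorAlgebra R M) = 0) :
    contract m σ (wedgeRight m u x) = x := by
  ext
  simp [coe_contract, coe_wedgeRight, ExteriorAlgebra.rightContract_mul_ι, hu, hx]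

theorem contract_ιMulti_of_init_eq_zero (x : Fin (m + 1) → M)
    (hx : ∀ j : Fin m, σ (x j.castSucc) = 0) :
    contract m σ (ιMulti R (m + 1) x) =
      σ (x (Fin.last m)) • ιMulti R m fun j => x j.castSucc := by
  ext
  rw [coe_contract, ιMulti_apply_coe, ExteriorAlgebra.ιMulti_succ_last,
    ExteriorAlgebra.rightContract_mul_ι, ExteriorAlgebra.rightContract_ιMulti_eq_zero σ _ hx,
    zero_mul, sub_zero]
  rfl

/-- When σ(u) = 1, the map is the projection onto ker σ along u, so elements killed by contraction
come from the exterior power of ker σ. -/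
theorem map_sub_smulRight_of_contract_eq_zero (u : M) (x : ⋀[R]^m M)
    (hx : rightContract σ (x : ExteriorAlgebra R M) = 0) :
    map m (LinearMap.id - σ.smulRight u) x = x := by
  ext
  rw [coe_map, ExteriorAlgebra.map_sub_smulRight σ u, hx, zero_mul, sub_zero]

theorem rightContract_map_eq_zero (f : N →ₗ[R] M) (h : σ ∘ₗ f = 0) (x : ⋀[R]^m N) :
    rightContract σ (map m f x : ExteriorAlgebra R M) = 0 := by
  rw [coe_map, ExteriorAlgebra.rightContract_map, h]
  simp [rightContract]

/-- An exterior power of a linear map vanishes if its degree exceeds the number of values of the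
map on a basis. -/
theorem map_eq_zero_of_card_lt {I J : Type*} [Finite I] [Fintype J] (b : Module.Basis I R M)
    (f : M →ₗ[R] N) (y : J → N) (p : I → J) (hf : ∀ i, f (b i) = y (p i))
    (h : Fintype.card J < m) : map m f = 0 := by
  refine linearMap_ext (Module.Basis.ext_alternating b fun c _ => ?_)
  obtain ⟨s, t, hst, he⟩ := Fintype.exists_ne_map_eq_of_card_lt (fun j => p (c j))
    (by simpa using h)
  simp only [LinearMap.compAlternatingMap_apply, map_apply_ιMulti, LinearMap.zero_apply]
  exact (ιMulti R m).map_eq_zero_of_eq _ (i := s) (j := t) (by simp [hf, he]) hst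

end exteriorPower

namespace TransfMonoid

open exteriorPower (ιMulti contract wedgeRight)

/-! ### The mean value form and the basis `w` -/

section Mean

variable {n : ℕ}

/-- The linear form on `ℂⁿ` taking the mean value of the coordinates. -/
noncomputable def mean (n : ℕ) : Module.Dual ℂ (Fin n → ℂ) :=
  (n : ℂ)⁻¹ • ∑ j, LinearMap.proj j

theorem mean_apply (x : Fin n → ℂ) : mean n x = (n : ℂ)⁻¹ * ∑ j, x j := by
  simp [mean]

theorem mean_naturalMap (f : FullTransf n) : mean n ∘ₗ naturalMap f = mean n := by
  ext1 i
  ext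
  simp only [LinearMap.comp_apply, mean_apply, sum_naturalMap]

theorem mean_comp_subtype : mean n ∘ₗ (aug n).subtype = 0 := by
  ext x
  have hx : ∑ j, x.1 j = 0 := x.2
  simp [mean_apply, hx]

/-- This normalization is why the mean is used instead of the coordinate sum: the differential then
has coefficient 1. -/
theorem mean_sum_v [NeZero n] : mean n (∑ j, v j) = 1 := by
  simp [mean_apply, map_sum, sum_v]

theorem mean_v_sub_v (i j : Fin n) : mean n (v i - v j) = 0 := by
  simp [mean_apply, sum_v]

theorem mean_w [NeZero n] (i : Fin n) : mean n (w i) = if i = lastOf i then 1 else 0 := by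
  unfold w
  split_ifs
  · exact mean_sum_v
  · exact mean_v_sub_v _ _

/-- The projection of `ℂⁿ` onto `Aug(ℂⁿ)` along the all-ones vector. -/
noncomputable def augProj (n : ℕ) [NeZero n] : (Fin n → ℂ) →ₗ[ℂ] aug n :=
  (LinearMap.id - (mean n).smulRight (∑ j, v j)).codRestrict (aug n) fun x => by
    have h : (n : ℂ)⁻¹ * ∑ k, (x - mean n x • ∑ j, v j : Fin n → ℂ) k = 0 := by
      rw [← mean_apply, map_sub, map_smul, mean_sum_v, smul_eq_mul, mul_one, sub_self]
    exact (mul_eq_zero.mp h).resolve_left (inv_ne_zero (NeZero.ne _))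

theorem subtype_comp_augProj [NeZero n] :
    (aug n).subtype ∘ₗ augProj n = LinearMap.id - (mean n).smulRight (∑ j, v j) :=
  LinearMap.subtype_comp_codRestrict _ _ _

theorem w_eq_augW {i : Fin n} (h : i ≠ lastOf i) : w i = (augW i : Fin n → ℂ) := if_neg h

theorem span_range_w : Submodule.span ℂ (Set.range (w : Fin n → Fin n → ℂ)) = ⊤ := by
  rcases Nat.eq_zero_or_pos n with rfl | hn
  · exact Subsingleton.elim _ _
  have : NeZero n := ⟨hn.ne'⟩
  set S := Submodule.span ℂ (Set.range (w : Fin n → Fin n → ℂ))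
  have hw (i : Fin n) : w i ∈ S := Submodule.subset_span ⟨i, rfl⟩
  set l : Fin n := lastOf ⟨0, hn⟩
  have hl (i : Fin n) : lastOf i = l := rfl
  have hsub (i : Fin n) : v i - v l ∈ S := by
    by_cases h : i = l
    · simp [h]
    · simpa [w, hl, h] using hw i
  have hone : ∑ j, v j ∈ S := by simpa [w, hl] using hw l
  have hlast : v l ∈ S := by
    -- Subtracting every v_i - v_l from the all-ones vector leaves n v_l, and n is invertible.
    have h : (n : ℂ) • v l ∈ S := by
      have h' := sub_mem hone (Submodule.sum_mem S fun i (_ : i ∈ Finset.univ) => hsub i)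
      simpa [Finset.sum_sub_distrib, Nat.cast_smul_eq_nsmul] using h'
    exact (Submodule.smul_mem_iff S (NeZero.ne (n : ℂ))).mp h
  rw [eq_top_iff, ← (Pi.basisFun ℂ (Fin n)).span_eq, Submodule.span_le]
  rintro _ ⟨i, rfl⟩
  rw [Pi.basisFun_apply]
  have h := add_mem (hsub i) hlast
  rwa [sub_add_cancel] at h

theorem linearIndependent_w : LinearIndependent ℂ (w : Fin n → Fin n → ℂ) :=
  linearIndependent_of_top_le_span_of_card_eq_finrank span_range_w.ge (by simp)

end Mean

/-! ### Wedges of standard basis vectors -/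

section Wedge

variable {n m : ℕ}

theorem naturalMap_ιMulti_v (f : FullTransf n) (c : Fin m → Fin n) :
    exteriorRep (naturalRep n) m f (ιMulti ℂ m fun j => v (c j)) =
      ιMulti ℂ m fun j => v (f (c j)) := by
  rw [exteriorRep_ιMulti]
  exact congrArg _ (funext fun j => naturalMap_v f (c j))

theorem exteriorPower_ext_v {W : Type*} [AddCommGroup W] [Module ℂ W]
    {f g : ⋀[ℂ]^m (Fin n → ℂ) →ₗ[ℂ] W}
    (h : ∀ c : Fin m → Fin n, Function.Injective c →
      f (ιMulti ℂ m fun j => v (c j)) = g (ιMulti ℂ m fun j => v (c j))) : f = g := by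
  refine exteriorPower.linearMap_ext
    (Module.Basis.ext_alternating (Pi.basisFun ℂ (Fin n)) fun c hc => ?_)
  simpa [v] using h c hc

theorem subsingleton_exteriorPower (h : n < m) : Subsingleton (⋀[ℂ]^m (Fin n → ℂ)) := by
  refine subsingleton_of_forall_eq 0 fun x => ?_
  have hid : (LinearMap.id : ⋀[ℂ]^m (Fin n → ℂ) →ₗ[ℂ] _) = 0 := exteriorPower_ext_v fun c hc => by
    have := Fintype.card_le_of_injective c hc
    simp only [Fintype.card_fin] at this
    omega
  exact LinearMap.congr_fun hid x

/-- A self-map with values `i 0, …, i (m - 1)` maps the `m`-th exterior power to the line spanned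
by `v (i 0) ∧ ⋯ ∧ v (i (m - 1))`. -/
theorem exteriorRep_comp_mem_span (i : Fin m → Fin n) (p : Fin n → Fin m)
    (g : FullTransf n) (hg : ∀ a, g a = i (p a)) (x : ⋀[ℂ]^m (Fin n → ℂ)) :
    ∃ a : ℂ, exteriorRep (naturalRep n) m g x = a • ιMulti ℂ m fun j => v (i j) := by
  set S := Submodule.span ℂ {ιMulti ℂ m fun j => (v (i j) : Fin n → ℂ)}
  -- On a wedge of the v_{c j}, either p ∘ c is a permutation, giving ± the generator of S, or two
  -- factors coincide.
  have h : S.mkQ ∘ₗ exteriorRep (naturalRep n) m g = 0 := by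
    refine exteriorPower_ext_v fun c _ => ?_
    rw [LinearMap.comp_apply, naturalMap_ιMulti_v, LinearMap.zero_apply, Submodule.mkQ_apply,
      Submodule.Quotient.mk_eq_zero]
    simp only [hg]
    by_cases hc : Function.Injective fun j => p (c j)
    · have hp := (ιMulti ℂ m).map_perm (fun j => (v (i j) : Fin n → ℂ))
        (Equiv.ofBijective _ (Finite.injective_iff_bijective.mp hc))
      have hS : (ιMulti ℂ m fun j => (v (i j) : Fin n → ℂ)) ∈ S :=
        Submodule.mem_span_singleton_self _
      have := Submodule.smul_of_tower_mem S (Equiv.Perm.sign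
        (Equiv.ofBijective _ (Finite.injective_iff_bijective.mp hc))) hS
      rw [← hp] at this
      exact this
    · rw [Function.Injective] at hc
      push Not at hc
      obtain ⟨s, t, hst, hne⟩ := hc
      rw [(ιMulti ℂ m).map_eq_zero_of_eq _ (i := s) (j := t) (by simp [hst]) hne]
      exact zero_mem S
  have hx := LinearMap.congr_fun h x
  rw [LinearMap.comp_apply, LinearMap.zero_apply, Submodule.mkQ_apply,
    Submodule.Quotient.mk_eq_zero, Submodule.mem_span_singleton] at hx
  obtain ⟨a, ha⟩ := hx
  exact ⟨a, ha.symm⟩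

/-- An idempotent self-map with values `i 0, …, i m` annihilates the kernel of the contraction with
the mean value form in degree `m + 1`. -/
theorem exists_fix_and_kill (i : Fin (m + 1) → Fin n) :
    ∃ g : FullTransf n, (∀ j, g (i j) = i j) ∧
      ∀ x : ⋀[ℂ]^(m + 1) (Fin n → ℂ), contract m (mean n) x = 0 →
        exteriorRep (naturalRep n) (m + 1) g x = 0 := by
  have : NeZero n := ⟨by rintro rfl; exact (i 0).elim0⟩
  set g : FullTransf n := i ∘ Function.invFun i
  refine ⟨g, fun j => Function.invFun_eq ⟨j, rfl⟩, fun x hx => ?_⟩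
  -- The element x is the contraction of x ∧ u, of degree m + 2. Contraction commutes with g, and
  -- Λ^{m+2}(g) = 0 because g has at most m + 1 values.
  rw [← exteriorPower.contract_wedgeRight_of_contract_eq_zero (mean n) (∑ j, v j) mean_sum_v x
    (congrArg Subtype.val hx)]
  change exteriorPower.map (m + 1) (naturalMap g) _ = 0
  rw [← mean_naturalMap g, ← exteriorPower.contract_map,
    exteriorPower.map_eq_zero_of_card_lt (Pi.basisFun ℂ (Fin n)) (naturalMap g)
      (fun j => v (i j)) (Function.invFun i) (fun a => by
        rw [Pi.basisFun_apply]; exact naturalMap_v g a) (by simp)]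
  simp

theorem exists_ιMulti_v_ne_zero (h : m ≤ n) :
    ∃ i : Fin m → Fin n, Function.Injective i ∧ (ιMulti ℂ m fun j => (v (i j) : Fin n → ℂ)) ≠ 0 := by
  obtain ⟨t, -, ht⟩ := Finset.exists_subset_card_eq (s := (Finset.univ : Finset (Fin n)))
    (n := m) (by simpa using h)
  let s : Set.powersetCard (Fin n) m := ⟨t, ht⟩
  refine ⟨Set.powersetCard.ofFinEmbEquiv.symm s, (Set.powersetCard.ofFinEmbEquiv.symm s).injective,
    ?_⟩
  have hb := ((Pi.basisFun ℂ (Fin n)).exteriorPower m).ne_zero s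
  rw [exteriorPower.basis_apply] at hb
  convert! hb using 1
  refine congrArg _ (funext fun j => ?_)
  simp [v]

/-- Otherwise the idempotent of `exists_fix_and_kill` would kill a nonzero wedge that it fixes. -/
theorem exists_contract_mean_ne_zero (h : m + 1 ≤ n) :
    ∃ x : ⋀[ℂ]^(m + 1) (Fin n → ℂ), contract m (mean n) x ≠ 0 := by
  obtain ⟨i, -, hi⟩ := exists_ιMulti_v_ne_zero h
  obtain ⟨g, hg, hg'⟩ := exists_fix_and_kill i
  refine ⟨ιMulti ℂ (m + 1) fun j => v (i j), fun hx => hi ?_⟩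
  rw [← hg' _ hx, naturalMap_ιMulti_v]
  simp only [hg]

/-- Every nonzero element of the `m`-th exterior power, `m < n`, survives under some self-map with
at most `m + 1` values. -/
theorem exists_exteriorRep_ne_zero (h : m + 1 ≤ n) {x : ⋀[ℂ]^m (Fin n → ℂ)} (hx : x ≠ 0) :
    ∃ (i : Fin (m + 1) → Fin n) (p : Fin n → Fin (m + 1)) (g : FullTransf n),
      Function.Injective i ∧ (∀ a, g a = i (p a)) ∧ exteriorRep (naturalRep n) m g x ≠ 0 := by
  set b := (Pi.basisFun ℂ (Fin n)).exteriorPower m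
  -- The set s indexes a basis wedge occurring in x, and a lies outside s since m < n. The map g
  -- below fixes s and collapses its complement to a.
  obtain ⟨s, hs⟩ : ∃ s, b.repr x s ≠ 0 := by
    by_contra! hc
    exact hx (b.repr.map_eq_zero_iff.mp (Finsupp.ext hc))
  obtain ⟨a, ha⟩ : ∃ a, a ∉ s.1 := by
    by_contra! hc
    have hcard := s.2
    rw [Set.powersetCard.mem_iff, Finset.eq_univ_iff_forall.mpr hc, Finset.card_univ,
      Fintype.card_fin] at hcard
    omega
  set e := Set.powersetCard.ofFinEmbEquiv.symm s
  have hes (j : Fin m) : e j ∈ s.1 :=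
    (Set.powersetCard.mem_range_ofFinEmbEquiv_symm_iff_mem s _).mp ⟨j, rfl⟩
  have hse {c : Fin n} (hc : c ∈ s.1) : ∃ j, e j = c :=
    (Set.powersetCard.mem_range_ofFinEmbEquiv_symm_iff_mem s c).mpr hc
  classical
  set i : Fin (m + 1) → Fin n := Fin.snoc (e : Fin m → Fin n) a
  have hinj : Function.Injective i :=
    Fin.snoc_injective_iff.mpr ⟨e.injective, fun ⟨j, hj⟩ => ha (hj ▸ hes j)⟩
  set p : Fin n → Fin (m + 1) := fun c => if h : c ∈ s.1 then (hse h).choose.castSucc else Fin.last m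
  have hp_mem {c : Fin n} (hc : c ∈ s.1) : i (p c) = c := by
    simp only [p, dif_pos hc, i, Fin.snoc_castSucc]
    exact (hse hc).choose_spec
  have hp_not_mem {c : Fin n} (hc : c ∉ s.1) : i (p c) = a := by
    simp only [p, dif_neg hc, i, Fin.snoc_last]
  set g : FullTransf n := fun c => i (p c)
  refine ⟨i, p, g, hinj, fun _ => rfl, fun h0 => hs ?_⟩
  -- The s-coordinate is g-invariant: any t ≠ s of the same size has an element outside s, which g
  -- sends to a, so the determinant computing the coordinate has a zero row.
  have hcoord : b.coord s ∘ₗ exteriorRep (naturalRep n) m g = b.coord s := by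
    refine b.ext fun t => ?_
    have hbt : b t = ιMulti ℂ m fun j => v (Set.powersetCard.ofFinEmbEquiv.symm t j) := by
      rw [exteriorPower.basis_apply]
      refine congrArg _ (funext fun j => ?_)
      simp [v]
    rw [LinearMap.comp_apply, hbt, naturalMap_ιMulti_v, ← hbt]
    by_cases hts : t = s
    · rw [hts] at hbt ⊢
      rw [hbt]
      refine congrArg _ (congrArg _ (funext fun j => congrArg _ (hp_mem (hes j))))
    · obtain ⟨c, hct, hcs⟩ := (Set.powersetCard.exists_mem_notMem_iff_ne t s).mp hts
      obtain ⟨j, rfl⟩ := (Set.powersetCard.mem_range_ofFinEmbEquiv_symm_iff_mem t c).mpr hct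
      rw [Module.Basis.coord_apply, Module.Basis.coord_apply, Module.Basis.repr_self,
        Finsupp.single_eq_of_ne (Ne.symm hts), ← Module.Basis.coord_apply, exteriorPower.basis_coord,
        exteriorPower.ιMultiDual_apply_ιMulti]
      refine Matrix.det_eq_zero_of_row_eq_zero j fun k => ?_
      have hk : e k ≠ a := fun h => ha (h ▸ hes k)
      have hg : g (Set.powersetCard.ofFinEmbEquiv.symm t j) = a := hp_not_mem hcs
      rw [Matrix.of_apply, hg, Module.Basis.coord_apply, Pi.basisFun_repr]
      exact Pi.single_eq_of_ne hk 1
  have := LinearMap.congr_fun hcoord x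
  rwa [LinearMap.comp_apply, h0, map_zero, eq_comm] at this

end Wedge

end TransfMonoid

namespace TransfMonoid

open exteriorPower (ιMulti contract wedgeRight)

/-! ### Module structure on exterior powers -/

section Module

variable {n m : ℕ}

/-- The linear map over the monoid algebra given by an equivariant linear map. -/
noncomputable def asModuleMap {G V W : Type*} [Monoid G] [AddCommGroup V] [Module ℂ V]
    [AddCommGroup W] [Module ℂ W] {ρ : Representation ℂ G V} {τ : Representation ℂ G W}
    (f : V →ₗ[ℂ] W) (h : ∀ g x, f (ρ g x) = τ g (f x)) :
    ρ.asModule →ₗ[MonoidAlgebra ℂ G] τ.asModule :=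
  Representation.IntertwiningMap.equivLinearMapAsModule ρ τ ⟨f, fun g => LinearMap.ext fun x => h g x⟩

theorem single_smul_wedge {G V : Type*} [Monoid G] [AddCommGroup V] [Module ℂ V]
    (ρ : Representation ℂ G V) (g : G) (x : Fin m → V) :
    (MonoidAlgebra.single g (1 : ℂ)) • wedge ρ x = wedge ρ fun j => ρ g (x j) := by
  rw [Representation.single_smul, one_smul]
  exact exteriorRep_ιMulti ρ m g x

theorem apply_mem_of_mem_asModule {G V : Type*} [Monoid G] [AddCommGroup V] [Module ℂ V]
    {ρ : Representation ℂ G V} (N : Submodule (MonoidAlgebra ℂ G) ρ.asModule) (g : G)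
    {x : ρ.asModule} (hx : x ∈ N) : (ρ g x : ρ.asModule) ∈ N := by
  have := N.smul_mem (MonoidAlgebra.single g (1 : ℂ)) hx
  rw [Representation.single_smul, one_smul] at this
  exact this

theorem mem_of_smul_mem_asModule {G V : Type*} [Monoid G] [AddCommGroup V] [Module ℂ V]
    {ρ : Representation ℂ G V} (N : Submodule (MonoidAlgebra ℂ G) ρ.asModule) {c : ℂ} (hc : c ≠ 0)
    {x : ρ.asModule} (hx : c • x ∈ N) : x ∈ N :=
  ((N.restrictScalars ℂ).smul_mem_iff hc).mp hx

/-- A submodule of an exterior power of the natural module that contains all wedges of standard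
basis vectors is everything. -/
theorem eq_top_of_forall_wedge_mem (N : Submodule (TransfAlg n) (ExtPow (naturalRep n) m))
    (h : ∀ c : Fin m → Fin n, wedge (naturalRep n) (fun j => v (c j)) ∈ N) : N = ⊤ := by
  let S : Submodule ℂ (⋀[ℂ]^m (Fin n → ℂ)) := N.restrictScalars ℂ
  have hS : S.mkQ = 0 := exteriorPower_ext_v fun c _ => by
    rw [LinearMap.zero_apply, Submodule.mkQ_apply, Submodule.Quotient.mk_eq_zero]
    exact h c
  refine eq_top_iff.mpr fun x _ => ?_
  exact (Submodule.Quotient.mk_eq_zero S).mp (LinearMap.congr_fun hS x)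

/-- Since i is injective, any assignment i_j ↦ c_j extends to a self-map, so this one wedge
generates. Positive degree supplies the nonempty domain needed by `Function.invFun`. -/
theorem eq_top_of_wedge_mem (N : Submodule (TransfAlg n) (ExtPow (naturalRep n) (m + 1)))
    {i : Fin (m + 1) → Fin n} (hi : Function.Injective i)
    (h : wedge (naturalRep n) (fun j => v (i j)) ∈ N) : N = ⊤ := by
  refine eq_top_of_forall_wedge_mem N fun c => ?_
  let g : FullTransf n := fun a => c (Function.invFun i a)
  have hg := N.smul_mem (MonoidAlgebra.single g (1 : ℂ)) h
  rw [single_smul_wedge] at hg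
  convert! hg using 2
  funext j
  refine Eq.trans ?_ (naturalMap_v _ _).symm
  exact congrArg (fun a => v (c a)) (Function.leftInverse_invFun hi j).symm

theorem contract_exteriorRep (g : FullTransf n) (x : ⋀[ℂ]^(m + 1) (Fin n → ℂ)) :
    contract m (mean n) (exteriorRep (naturalRep n) (m + 1) g x) =
      exteriorRep (naturalRep n) m g (contract m (mean n) x) := by
  change contract m (mean n) (exteriorPower.map (m + 1) (naturalMap g) x) = _
  rw [exteriorPower.contract_map, mean_naturalMap]
  rfl

theorem map_subtype_exteriorRep (g : FullTransf n) (x : ⋀[ℂ]^m (aug n)) :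
    exteriorPower.map m (aug n).subtype (exteriorRep (augRep n) m g x) =
      exteriorRep (naturalRep n) m g (exteriorPower.map m (aug n).subtype x) := by
  change exteriorPower.map m _ (exteriorPower.map m (augRep n g) x) =
    exteriorPower.map m (naturalMap g) (exteriorPower.map m _ x)
  rw [← LinearMap.comp_apply, ← LinearMap.comp_apply, ← exteriorPower.map_comp,
    ← exteriorPower.map_comp]
  rfl

theorem map_subtype_injective : Function.Injective (exteriorPower.map m (aug n).subtype) :=
  exteriorPower.map_injective_field (Submodule.subtype_injective _)

theorem map_subtype_map_augProj [NeZero n] (x : ⋀[ℂ]^m (Fin n → ℂ))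
    (hx : ExteriorAlgebra.rightContract (mean n) (x : ExteriorAlgebra ℂ (Fin n → ℂ)) = 0) :
    exteriorPower.map m (aug n).subtype (exteriorPower.map m (augProj n) x) = x := by
  rw [← LinearMap.comp_apply, ← exteriorPower.map_comp, subtype_comp_augProj,
    exteriorPower.map_sub_smulRight_of_contract_eq_zero (mean n) _ x hx]

/-- The differential `⋀^(m+1) ℂⁿ → ⋀^m ℂⁿ`. -/
noncomputable def diff (n m : ℕ) :
    ExtPow (naturalRep n) (m + 1) →ₗ[TransfAlg n] ExtPow (naturalRep n) m :=
  asModuleMap (contract m (mean n)) contract_exteriorRep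

/-- The inclusion `⋀^m Aug(ℂⁿ) → ⋀^m ℂⁿ`. -/
noncomputable def augIncl (n m : ℕ) :
    ExtPow (augRep n) m →ₗ[TransfAlg n] ExtPow (naturalRep n) m :=
  asModuleMap (exteriorPower.map m (aug n).subtype) map_subtype_exteriorRep

theorem augIncl_wedge (x : Fin m → aug n) :
    augIncl n m (wedge (augRep n) x) = wedge (naturalRep n) fun j => (x j : Fin n → ℂ) :=
  exteriorPower.map_apply_ιMulti _ _

theorem augIncl_injective : Function.Injective (augIncl n m) :=
  map_subtype_injective

/-- The augmentation `⋀^(m+1) ℂⁿ → ⋀^m Aug(ℂⁿ)`. -/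
noncomputable def augDiff (n m : ℕ) [NeZero n] :
    ExtPow (naturalRep n) (m + 1) →ₗ[TransfAlg n] ExtPow (augRep n) m :=
  asModuleMap (exteriorPower.map m (augProj n) ∘ₗ contract m (mean n)) fun g x => by
    -- The projection `augProj` is in general not equivariant, as self-maps need not fix the
    -- all-ones vector. Equivariance is checked after the injection into Λ^m(ℂⁿ), where the
    -- composite is plain contraction.
    have hd (y : ⋀[ℂ]^(m + 1) (Fin n → ℂ)) := map_subtype_map_augProj (contract m (mean n) y)
      (ExteriorAlgebra.rightContract_rightContract _ _)
    refine map_subtype_injective ?_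
    rw [map_subtype_exteriorRep, LinearMap.comp_apply, LinearMap.comp_apply, hd, hd,
      contract_exteriorRep]

theorem augIncl_augDiff [NeZero n] (x : ExtPow (naturalRep n) (m + 1)) :
    augIncl n m (augDiff n m x) = diff n m x :=
  map_subtype_map_augProj (contract m (mean n) x) (ExteriorAlgebra.rightContract_rightContract _ _)

theorem exists_diff_eq [NeZero n] (x : ⋀[ℂ]^m (Fin n → ℂ))
    (hx : ExteriorAlgebra.rightContract (mean n) (x : ExteriorAlgebra ℂ (Fin n → ℂ)) = 0) :
    ∃ y, diff n m y = x :=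
  ⟨wedgeRight m (∑ j, v j) x,
    exteriorPower.contract_wedgeRight_of_contract_eq_zero _ _ mean_sum_v x hx⟩

theorem exact_diff [NeZero n] : Function.Exact (diff n (m + 1)) (diff n m) := by
  refine fun x => ⟨fun hx => exists_diff_eq x (congrArg Subtype.val hx), ?_⟩
  rintro ⟨y, rfl⟩
  exact exteriorPower.contract_contract (mean n) y

theorem augDiff_eq_zero_iff [NeZero n] (x : ExtPow (naturalRep n) (m + 1)) :
    augDiff n m x = 0 ↔ diff n m x = 0 := by
  rw [← augIncl_augDiff, LinearMap.map_eq_zero_iff _ augIncl_injective]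

theorem augDiff_surjective [NeZero n] : Function.Surjective (augDiff n m) := by
  intro x
  obtain ⟨y, hy⟩ := exists_diff_eq (augIncl n m x) 
    (exteriorPower.rightContract_map_eq_zero (mean n) _ mean_comp_subtype x)
  exact ⟨y, augIncl_injective ((augIncl_augDiff y).trans hy)⟩

/-- The middle of the short exact sequence used for dimension shifting. -/
theorem exact_augIncl_augDiff [NeZero n] :
    Function.Exact (augIncl n (m + 1)) (augDiff n m) := by
  intro x
  rw [augDiff_eq_zero_iff]
  constructor
  · exact fun hx => ⟨_, map_subtype_map_augProj x (congrArg Subtype.val hx)⟩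
  · rintro ⟨y, rfl⟩
    exact Subtype.ext (exteriorPower.rightContract_map_eq_zero (mean n) _ mean_comp_subtype y)

/-- The kernel of the differential is superfluous. -/
theorem eq_top_of_ker_diff_sup_eq_top
    (N : Submodule (TransfAlg n) (ExtPow (naturalRep n) (m + 1)))
    (h : LinearMap.ker (diff n m) ⊔ N = ⊤) : N = ⊤ := by
  refine eq_top_of_forall_wedge_mem N fun c => ?_
  -- Write the wedge as x + y with x in the kernel and y in N. Applying g fixes the wedge and kills
  -- x, so the wedge equals g y, which lies in N.
  obtain ⟨g, hg, hker⟩ := exists_fix_and_kill c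
  obtain ⟨x, hx, y, hy, hxy⟩ := Submodule.mem_sup.mp
    (h.ge (Submodule.mem_top (x := wedge (naturalRep n) fun j => v (c j))))
  have hgy := apply_mem_of_mem_asModule N g hy
  have hgx : exteriorRep (naturalRep n) (m + 1) g x = 0 := hker x hx
  have hsum := congrArg (exteriorRep (naturalRep n) (m + 1) g) hxy
  have hfix : exteriorRep (naturalRep n) (m + 1) g (wedge (naturalRep n) fun j => v (c j)) =
      wedge (naturalRep n) fun j => v (c j) := by
    refine (naturalMap_ιMulti_v g c).trans ?_
    simp only [hg]
    rfl
  rw [hfix] at hsum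
  rw [← hsum]
  have hadd : exteriorRep (naturalRep n) (m + 1) g (x + y) =
      exteriorRep (naturalRep n) (m + 1) g y :=
    (map_add (exteriorRep (naturalRep n) (m + 1) g) x y).trans
      ((congrArg (· + _) hgx).trans (zero_add _))
  rw [hadd]
  exact hgy

end Module

end TransfMonoid

namespace TransfMonoid

open exteriorPower (ιMulti contract wedgeRight)

/-! ### Projectivity by antisymmetrization -/

section Projective

variable {n m : ℕ}

/-- A function `Fin n → Fin n` as an element of the full transformation monoid. -/
def toTransf (f : Fin n → Fin n) : FullTransf n := f

theorem mul_toTransf (g : FullTransf n) (f : Fin n → Fin n) :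
    g * toTransf f = toTransf fun a => g (f a) := rfl

/-- The multilinear map to the monoid algebra with `(v (c 0), …, v (c (m - 1))) ↦ c ∘ p`. -/
noncomputable def liftMultilinear (p : Fin n → Fin m) :
    MultilinearMap ℂ (fun _ : Fin m => Fin n → ℂ) (TransfAlg n) :=
  ∑ c : Fin m → Fin n, ((MultilinearMap.mkPiAlgebra ℂ (Fin m) ℂ).compLinearMap fun j =>
    LinearMap.proj (c j)).smulRight (MonoidAlgebra.single (toTransf fun a => c (p a)) (1 : ℂ))

theorem liftMultilinear_v (p : Fin n → Fin m) (c : Fin m → Fin n) :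
    liftMultilinear p (fun j => v (c j)) =
      MonoidAlgebra.single (toTransf fun a => c (p a)) (1 : ℂ) := by
  rw [liftMultilinear, sum_apply, Finset.sum_eq_single c]
  · simp [v]
  · intro d _ hd
    obtain ⟨j, hj⟩ := Function.ne_iff.mp hd
    have h0 : ∏ j, (v (c j) : Fin n → ℂ) (d j) = 0 :=
      Finset.prod_eq_zero (Finset.mem_univ j) (by simp [v, hj])
    simp [h0]
  · simp

/-- The linear map from the exterior power of `ℂⁿ` to the monoid algebra with
`v (c 0) ∧ ⋯ ∧ v (c (m - 1)) ↦ (m!)⁻¹ ∑_σ sign σ • (c ∘ σ ∘ p)`. -/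
noncomputable def liftLinear (p : Fin n → Fin m) : ⋀[ℂ]^m (Fin n → ℂ) →ₗ[ℂ] TransfAlg n :=
  ((m.factorial : ℂ)⁻¹) •
    exteriorPower.alternatingMapLinearEquiv (MultilinearMap.alternatization (liftMultilinear p))

theorem liftLinear_v (p : Fin n → Fin m) (c : Fin m → Fin n) :
    liftLinear p (ιMulti ℂ m fun j => v (c j)) = (m.factorial : ℂ)⁻¹ •
      ∑ τ : Equiv.Perm (Fin m), Equiv.Perm.sign τ •
        MonoidAlgebra.single (toTransf fun a => c (τ (p a))) (1 : ℂ) := by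
  rw [liftLinear, LinearMap.smul_apply, exteriorPower.alternatingMapLinearEquiv_apply_ιMulti,
    MultilinearMap.alternatization_apply]
  congr 1
  refine Finset.sum_congr rfl fun τ _ => ?_
  rw [MultilinearMap.domDomCongr_apply]
  exact congrArg _ (liftMultilinear_v p fun j => c (τ j))

/-- Left multiplication by g composes after c, while antisymmetrization permutes before c, so the
two commute. -/
theorem liftLinear_exteriorRep (p : Fin n → Fin m) (g : FullTransf n) (x : ⋀[ℂ]^m (Fin n → ℂ)) :
    liftLinear p (exteriorRep (naturalRep n) m g x) =
      MonoidAlgebra.single g (1 : ℂ) * liftLinear p x := by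
  have h : liftLinear p ∘ₗ exteriorRep (naturalRep n) m g =
      LinearMap.mulLeft ℂ (MonoidAlgebra.single g (1 : ℂ)) ∘ₗ liftLinear p :=
    exteriorPower_ext_v fun c _ => by
      rw [LinearMap.comp_apply, naturalMap_ιMulti_v, liftLinear_v, LinearMap.comp_apply,
        liftLinear_v, LinearMap.mulLeft_apply, mul_smul_comm, Finset.mul_sum]
      congr 1
      refine Finset.sum_congr rfl fun τ _ => ?_
      rw [mul_smul_comm, MonoidAlgebra.single_mul_single, one_mul, mul_toTransf]
  exact LinearMap.congr_fun h x

/-- The orbit map a ↦ a · (v_1 ∧ ⋯ ∧ v_{m+1}) is split by `liftLinear p` for a left inverse p of i.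
Degree 0 is excluded: p would have to map into an empty set. -/
theorem projective_extPow (n m : ℕ) :
    Module.Projective (TransfAlg n) (ExtPow (naturalRep n) (m + 1)) := by
  by_cases hmn : m + 1 ≤ n
  · let i : Fin (m + 1) → Fin n := Fin.castLE hmn
    have hi : Function.Injective i := Fin.castLE_injective hmn
    let p : Fin n → Fin (m + 1) := Function.invFun i
    let s : ExtPow (naturalRep n) (m + 1) →ₗ[TransfAlg n] TransfAlg n :=
      MonoidAlgebra.equivariantOfLinearOfComm
        (liftLinear p ∘ₗ (exteriorRep (naturalRep n) (m + 1)).asModuleEquiv.toLinearMap)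
        fun g x => by
          rw [Representation.single_smul, one_smul]
          exact liftLinear_exteriorRep p g x
    let π : TransfAlg n →ₗ[TransfAlg n] ExtPow (naturalRep n) (m + 1) :=
      LinearMap.toSpanSingleton _ _ (wedge (naturalRep n) fun j => v (i j))
    refine Module.Projective.of_split s π (LinearMap.ext fun x => ?_)
    let f : ⋀[ℂ]^(m + 1) (Fin n → ℂ) →ₗ[ℂ] ExtPow (naturalRep n) (m + 1) :=
      π.restrictScalars ℂ ∘ₗ liftLinear p
    suffices hf : f = (exteriorRep (naturalRep n) (m + 1)).asModuleEquiv.symm.toLinearMap from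
      LinearMap.congr_fun hf x
    refine exteriorPower_ext_v (W := ExtPow (naturalRep n) (m + 1)) fun c _ => ?_
    change π (liftLinear p _) = wedge (naturalRep n) fun j => v (c j)
    have hτ (τ : Equiv.Perm (Fin (m + 1))) :
        π (MonoidAlgebra.single (toTransf fun a => c (τ (p a))) (1 : ℂ)) =
          (Equiv.Perm.sign τ : ℤ) • wedge (naturalRep n) fun j => v (c j) := by
      rw [LinearMap.toSpanSingleton_apply, single_smul_wedge]
      refine Eq.trans ?_ ((ιMulti ℂ (m + 1)).map_perm (fun j => (v (c j) : Fin n → ℂ)) τ)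
      refine congrArg (ιMulti ℂ (m + 1)) (funext fun j => (naturalMap_v _ _).trans ?_)
      exact congrArg (fun a => v (c (τ a))) (Function.leftInverse_invFun hi j)
    -- The sign from antisymmetrizing cancels the sign from reordering, so all (m + 1)! terms give
    -- the same wedge.
    have hterm (τ : Equiv.Perm (Fin (m + 1))) :
        π.restrictScalars ℂ (Equiv.Perm.sign τ •
          MonoidAlgebra.single (toTransf fun a => c (τ (p a))) (1 : ℂ)) =
          wedge (naturalRep n) fun j => v (c j) := by
      rw [Units.smul_def, map_zsmul, LinearMap.restrictScalars_apply, hτ]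
      rcases Int.units_eq_one_or (Equiv.Perm.sign τ) with h | h
      · simp [h]
      · simp only [h, Units.val_neg, Units.val_one, neg_smul, one_smul]
        exact neg_neg (wedge (naturalRep n) fun j => v (c j))
    change π.restrictScalars ℂ (liftLinear p _) = _
    rw [liftLinear_v, map_smul, map_sum, Finset.sum_congr rfl fun τ _ => hterm τ,
      Finset.sum_const, Finset.card_univ, Fintype.card_perm, Fintype.card_fin,
      ← Nat.cast_smul_eq_nsmul ℂ, smul_smul, 
      inv_mul_cancel₀ (Nat.cast_ne_zero.mpr (Nat.factorial_ne_zero _)), one_smul]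
  · have : Subsingleton (ExtPow (naturalRep n) (m + 1)) :=
      subsingleton_exteriorPower (n := n) (m := m + 1) (by omega)
    infer_instance

end Projective

/-! ### Simplicity of the exterior powers of the augmentation -/

section Simple

variable {n m : ℕ}

theorem nontrivial_extPow_aug (h : m + 1 ≤ n) : Nontrivial (ExtPow (augRep n) m) := by
  have : NeZero n := ⟨by omega⟩
  obtain ⟨x, hx⟩ := exists_contract_mean_ne_zero h
  refine ⟨augDiff n m x, 0, fun h0 => hx ?_⟩
  exact (augDiff_eq_zero_iff x).mp h0

theorem isSimpleModule_extPow_aug (h : m + 1 ≤ n) :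
    IsSimpleModule (TransfAlg n) (ExtPow (augRep n) m) := by
  have : NeZero n := ⟨by omega⟩
  have := nontrivial_extPow_aug h
  refine (isSimpleModule_iff _ _).mpr ⟨fun N => ?_⟩
  refine or_iff_not_imp_left.mpr fun hN => ?_
  obtain ⟨x, hxN, hx⟩ := (Submodule.ne_bot_iff N).mp hN
  obtain ⟨y, rfl⟩ := augDiff_surjective x
  have hy : contract m (mean n) y ≠ 0 := fun h0 => hx ((augDiff_eq_zero_iff y).mpr h0)
  -- The map g keeps the contraction of y nonzero and sends y to a multiple of a single wedge; that
  -- multiple is nonzero because its contraction is.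
  obtain ⟨i, p, g, hi, hg, hne⟩ := exists_exteriorRep_ne_zero h hy
  obtain ⟨a, ha⟩ := exteriorRep_comp_mem_span i p g hg y
  have hgy : (exteriorRep (naturalRep n) (m + 1) g y : ExtPow (naturalRep n) (m + 1)) ∈
    N.comap (augDiff n m) := apply_mem_of_mem_asModule _ g hxN
  have ha0 : a ≠ 0 := by
    rintro rfl
    exact hne ((contract_exteriorRep g y).symm.trans
      ((congrArg (contract m (mean n)) (ha.trans (zero_smul ℂ _))).trans (map_zero _)))
  have htop : N.comap (augDiff n m) = ⊤ := by
    refine eq_top_of_wedge_mem _ hi ?_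
    rw [ha] at hgy
    exact mem_of_smul_mem_asModule (x := wedge (naturalRep n) fun j => v (i j)) _ ha0 hgy
  rw [eq_top_iff]
  intro z _
  obtain ⟨z, rfl⟩ := augDiff_surjective z
  exact htop.ge (Submodule.mem_top (x := z))

end Simple

end TransfMonoid

namespace TransfMonoid

open exteriorPower (ιMulti contract)
open CategoryTheory

/-! ### Minimality criterion and dimension shifting -/

section General

universe u w

variable {A : Type u} [Ring A] {L P M : Type w} [AddCommGroup L] [Module A L] [AddCommGroup P]
  [Module A P] [AddCommGroup M] [Module A M]

theorem IsProjectiveResolution.isMinimal_of_superfluous {P : ℕ → Type w}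
    [∀ q, AddCommGroup (P q)] [∀ q, Module A (P q)] {d : ∀ q, P (q + 1) →ₗ[A] P q}
    {ε : P 0 →ₗ[A] M} (h : IsProjectiveResolution d ε)
    (hε : ∀ N : Submodule A (P 0), LinearMap.ker ε ⊔ N = ⊤ → N = ⊤)
    (hd : ∀ q, ∀ N : Submodule A (P (q + 1)), LinearMap.ker (d q) ⊔ N = ⊤ → N = ⊤) :
    IsMinimalProjectiveResolution d ε where
  toIsProjectiveResolution := h
  cover_zero :=
    { projective := h.projective 0
      surjective := LinearMap.surjective_rangeRestrict ε
      superfluous := fun N hN => hε N (by rwa [LinearMap.ker_rangeRestrict] at hN) }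
  cover_succ q :=
    { projective := h.projective (q + 1)
      surjective := LinearMap.surjective_rangeRestrict (d q)
      superfluous := fun N hN => hd q N (by rwa [LinearMap.ker_rangeRestrict] at hN) }

theorem hasProjectiveDimensionLT_one_iff [Small.{w} A] :
    HasProjectiveDimensionLT (ModuleCat.of A M) 1 ↔ Module.Projective A M := by
  rw [IsProjective.iff_projective M]
  exact ⟨fun _ => inferInstance, fun _ => inferInstance⟩

/-- The shift starts at k + 2: one step lower it would say that M is projective exactly when L = 0,
which fails for split sequences. -/
theorem hasProjectiveDimensionLT_iff_of_exact [Small.{w} A] (hP : Module.Projective A P)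
    {f : L →ₗ[A] P} {g : P →ₗ[A] M} (hf : Function.Injective f) (hfg : Function.Exact f g)
    (hg : Function.Surjective g) (k : ℕ) :
    HasProjectiveDimensionLT (ModuleCat.of A M) (k + 2) ↔
      HasProjectiveDimensionLT (ModuleCat.of A L) (k + 1) := by
  let S : ShortComplex (ModuleCat A) :=
    ModuleCat.shortComplexOfCompEqZero f g hfg.linearMap_comp_eq_zero
  have hS : S.ShortExact := ModuleCat.shortComplex_shortExact S hfg hf hg
  exact hS.hasProjectiveDimensionLT_X₃_iff k ((IsProjective.iff_projective P).mp hP)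

theorem projectiveDimension_eq_of_linearEquiv (e : L ≃ₗ[A] M) :
    projectiveDimension (ModuleCat.of A L) = projectiveDimension (ModuleCat.of A M) :=
  projectiveDimension_eq_of_iso e.toModuleIso

end General

/-! ### The minimal resolution and its values on the basis w -/

section Resolution

variable {n m : ℕ}

theorem projective_extPow_of_pos (h : 0 < m) :
    Module.Projective (TransfAlg n) (ExtPow (naturalRep n) m) := by
  obtain ⟨k, rfl⟩ := Nat.exists_eq_add_of_le' h
  exact projective_extPow n k

theorem ker_augDiff [NeZero n] : LinearMap.ker (augDiff n m) = LinearMap.ker (diff n m) :=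
  Submodule.ext augDiff_eq_zero_iff

theorem isProjectiveResolution_diff (n k : ℕ) [NeZero n] :
    IsProjectiveResolution (A := TransfAlg n)
      (P := fun q => ExtPow (naturalRep n) (k + 1 + q)) (M := ExtPow (augRep n) k)
      (fun q => diff n (k + 1 + q)) (augDiff n k) where
  projective q := projective_extPow_of_pos (by omega)
  surjective := augDiff_surjective
  exact_zero := fun x => by
    refine Iff.trans (augDiff_eq_zero_iff x) ?_
    exact exact_diff x
  exact_succ q := exact_diff

theorem isMinimalProjectiveResolution_diff (n k : ℕ) [NeZero n] :
    IsMinimalProjectiveResolution (A := TransfAlg n)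
      (P := fun q => ExtPow (naturalRep n) (k + 1 + q)) (M := ExtPow (augRep n) k)
      (fun q => diff n (k + 1 + q)) (augDiff n k) :=
  (isProjectiveResolution_diff n k).isMinimal_of_superfluous
    (fun N h => eq_top_of_ker_diff_sup_eq_top (n := n) (m := k) N
      ((congrArg (· ⊔ N) (ker_augDiff (n := n) (m := k)).symm).trans h))
    (fun q N h => eq_top_of_ker_diff_sup_eq_top (n := n) (m := k + 1 + q) N h)

theorem diff_wedge_w [NeZero n] (i : Fin (m + 1) → Fin n) (hi : StrictMono i) :
    diff n m (wedge (naturalRep n) fun j => w (i j)) =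
      if i (Fin.last m) = lastOf (i (Fin.last m)) then
        wedge (naturalRep n) fun j : Fin m => w (i j.castSucc) else 0 := by
  refine (exteriorPower.contract_ιMulti_of_init_eq_zero (mean n) (fun j => w (i j))
    fun j => ?_).trans ?_
  -- Indices increase, so only the last factor can be w_n, the one basis vector of nonzero mean.
  · rw [mean_w, if_neg fun h => ?_]
    have hlt : i j.castSucc < i (Fin.last m) := hi (Fin.castSucc_lt_last j)
    have h1 := (i (Fin.last m)).isLt
    rw [h, Fin.lt_def] at hlt
    simp only [lastOf] at hlt
    omega
  · rw [mean_w]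
    split_ifs
    · exact one_smul ℂ _
    · exact zero_smul ℂ _

theorem augDiff_wedge_w [NeZero n] (i : Fin (m + 1) → Fin n) (hi : StrictMono i) :
    augDiff n m (wedge (naturalRep n) fun j => w (i j)) =
      if i (Fin.last m) = lastOf (i (Fin.last m)) then
        wedge (augRep n) fun j : Fin m => augW (i j.castSucc) else 0 := by
  refine augIncl_injective ?_
  rw [augIncl_augDiff, diff_wedge_w i hi]
  split_ifs with h
  · rw [augIncl_wedge]
    congr 1
    funext j
    refine w_eq_augW fun hj => ?_
    have hlt : i j.castSucc < i (Fin.last m) := hi (Fin.castSucc_lt_last j)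
    have h1 := (i (Fin.last m)).isLt
    rw [hj, Fin.lt_def] at hlt
    simp only [lastOf] at hlt
    omega
  · rw [map_zero]

end Resolution

/-! ### Projective dimensions -/

section ProjectiveDimension

variable {n m : ℕ}

/-- The image of a section would complement the superfluous kernel, hence be everything, forcing the
kernel to vanish. But the kernel is Λ^{m+1}(Aug), nonzero as m + 2 ≤ n. -/
theorem not_projective_extPow_aug (h : m + 2 ≤ n) :
    ¬ Module.Projective (TransfAlg n) (ExtPow (augRep n) m) := by
  intro hproj
  have : NeZero n := ⟨by omega⟩
  obtain ⟨s, hs⟩ := Module.projective_lifting_property (augDiff n m) LinearMap.id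
    augDiff_surjective
  have hs' (x : ExtPow (augRep n) m) : augDiff n m (s x) = x := LinearMap.congr_fun hs x
  have htop : LinearMap.range s = ⊤ := by
    refine eq_top_of_ker_diff_sup_eq_top _ (eq_top_iff.mpr fun x _ => ?_)
    rw [← ker_augDiff, ← sub_add_cancel x (s (augDiff n m x))]
    refine Submodule.add_mem_sup ?_ (LinearMap.mem_range_self _ _)
    rw [LinearMap.mem_ker, map_sub, hs', sub_self]
  have := nontrivial_extPow_aug (n := n) (m := m + 1) h
  obtain ⟨z, hz⟩ := exists_ne (0 : ExtPow (augRep n) (m + 1))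
  obtain ⟨u, hu⟩ := LinearMap.range_eq_top.mp htop (augIncl n (m + 1) z)
  have h0 : augDiff n m (augIncl n (m + 1) z) = 0 :=
    exact_augIncl_augDiff.apply_apply_eq_zero z
  rw [← hu, hs'] at h0
  rw [h0, map_zero] at hu
  exact hz (augIncl_injective (hu.symm.trans (map_zero _).symm))

/-- The object of the module category given by an exterior power of `Aug(ℂⁿ)`. -/
noncomputable abbrev augObj (n m : ℕ) : ModuleCat (TransfAlg n) :=
  ModuleCat.of (TransfAlg n) (ExtPow (augRep n) m)

theorem hasProjectiveDimensionLT_augObj_iff (n m k : ℕ) [NeZero n] :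
    HasProjectiveDimensionLT (augObj n m) (k + 2) ↔
      HasProjectiveDimensionLT (augObj n (m + 1)) (k + 1) :=
  hasProjectiveDimensionLT_iff_of_exact (A := TransfAlg n) (L := ExtPow (augRep n) (m + 1))
    (P := ExtPow (naturalRep n) (m + 1)) (M := ExtPow (augRep n) m) (projective_extPow n m)
    (f := augIncl n (m + 1)) (g := augDiff n m) augIncl_injective exact_augIncl_augDiff
    augDiff_surjective k

/-- Here n = m + 1, and the kernel of Λ^n(ℂⁿ) → Λ^{n-1}(Aug) is the image of Λ^{n+1}(ℂⁿ) = 0, so the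
map is an isomorphism. -/
theorem projective_extPow_aug_top (m : ℕ) :
    Module.Projective (TransfAlg (m + 1)) (ExtPow (augRep (m + 1)) m) := by
  have hinj : Function.Injective (augDiff (m + 1) m) := by
    refine (injective_iff_map_eq_zero _).mpr fun x hx => ?_
    have : Subsingleton (ExtPow (naturalRep (m + 1)) (m + 1 + 1)) :=
      subsingleton_exteriorPower (by omega)
    obtain ⟨y, rfl⟩ := (exact_diff x).mp ((augDiff_eq_zero_iff x).mp hx)
    rw [Subsingleton.elim y 0, map_zero]
  have := projective_extPow (m + 1) m
  exact Module.Projective.of_equiv (LinearEquiv.ofBijective _ ⟨hinj, augDiff_surjective⟩)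

theorem hasProjectiveDimensionLT_augObj (k : ℕ) :
    ∀ m, n = m + k + 1 → HasProjectiveDimensionLT (augObj n m) (k + 1) := by
  induction k with
  | zero =>
    rintro m rfl
    exact (hasProjectiveDimensionLT_one_iff (A := TransfAlg (m + 1))
      (M := ExtPow (augRep (m + 1)) m)).mpr (projective_extPow_aug_top m)
  | succ k ih =>
    intro m hm
    have : NeZero n := ⟨by omega⟩
    exact (hasProjectiveDimensionLT_augObj_iff n m k).mpr (ih (m + 1) (by omega))

theorem not_hasProjectiveDimensionLT_augObj (k : ℕ) :
    ∀ m, m + k + 1 ≤ n → ¬ HasProjectiveDimensionLT (augObj n m) k := by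
  induction k with
  | zero =>
    intro m hm h
    have hz := isZero_of_hasProjectiveDimensionLT_zero (augObj n m)
    have := nontrivial_extPow_aug (n := n) (m := m) hm
    exact not_subsingleton (ExtPow (augRep n) m) (ModuleCat.subsingleton_of_isZero hz)
  | succ k ih =>
    intro m hm
    have : NeZero n := ⟨by omega⟩
    -- Non-projectivity is a separate base case because the shift only applies from bound 2 on.
    rcases k with _ | k
    · intro h
      exact not_projective_extPow_aug (n := n) (m := m) (by omega)
        ((hasProjectiveDimensionLT_one_iff (A := TransfAlg n) (M := ExtPow (augRep n) m)).mp h)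
    · rw [hasProjectiveDimensionLT_augObj_iff]
      exact ih (m + 1) (by omega)

theorem projectiveDimension_augObj (h : m + 1 ≤ n) :
    projectiveDimension (augObj n m) = ((n - (m + 1) : ℕ) : ℕ∞) := by
  refine le_antisymm ?_ ?_
  · exact (projectiveDimension_le_iff _ _).mpr
      (hasProjectiveDimensionLT_augObj (n - (m + 1)) m (by omega))
  · exact (projectiveDimension_ge_iff _ _).mpr
      (not_hasProjectiveDimensionLT_augObj (n - (m + 1)) m (by omega))

/-- The zeroth exterior power of `Aug(ℂⁿ)` is the trivial module. -/
noncomputable def extPowZeroEquiv (n : ℕ) :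
    ExtPow (augRep n) 0 ≃ₗ[TransfAlg n] TrivialModule n :=
  LinearEquiv.ofBijective
    (asModuleMap (τ := Representation.trivial ℂ (FullTransf n) ℂ)
      (exteriorPower.zeroEquiv ℂ (aug n)).toLinearMap fun g x => by
        exact LinearMap.congr_fun (exteriorPower.zeroEquiv_naturality (augRep n g)) x)
    (exteriorPower.zeroEquiv ℂ (aug n)).bijective

end ProjectiveDimension

end TransfMonoid

open TransfMonoid CategoryTheory in
theorem corollaryc (n r : ℕ) (hr : 1 ≤ r) (hrn : r ≤ n) :
    IsSimpleModule (TransfAlg n) (ExtPow (augRep n) (r - 1)) ∧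
    (LinearIndependent ℂ (w : Fin n → Fin n → ℂ) ∧
      Submodule.span ℂ (Set.range (w : Fin n → Fin n → ℂ)) = ⊤) ∧
    (∃ (d : ∀ q : ℕ,
          ExtPow (naturalRep n) (r + (q + 1)) →ₗ[TransfAlg n] ExtPow (naturalRep n) (r + q))
        (d₀ : ExtPow (naturalRep n) r →ₗ[TransfAlg n] ExtPow (augRep n) (r - 1)),
      (∀ (q : ℕ) (i : Fin (r + q + 1) → Fin n), StrictMono i →
        d q (wedge (naturalRep n) fun j => w (i j)) =
          if i (Fin.last (r + q)) = lastOf (i (Fin.last (r + q))) then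
            wedge (naturalRep n) fun j : Fin (r + q) => w (i j.castSucc)
          else 0) ∧
      (∀ i : Fin r → Fin n, StrictMono i →
        d₀ (wedge (naturalRep n) fun j => w (i j)) =
          if i ⟨r - 1, by omega⟩ = lastOf (i ⟨r - 1, by omega⟩) then
            wedge (augRep n) fun j : Fin (r - 1) => augW (i (Fin.castLE (by omega) j))
          else 0) ∧
      (∀ q : ℕ, n - r < q → Subsingleton (ExtPow (naturalRep n) (r + q))) ∧
      IsMinimalProjectiveResolution (A := TransfAlg n) (P := fun q => ExtPow (naturalRep n) (r + q))
        (M := ExtPow (augRep n) (r - 1)) d d₀) ∧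
    projectiveDimension (ModuleCat.of (TransfAlg n) (ExtPow (augRep n) (r - 1))) =
      ((n - r : ℕ) : ℕ∞) ∧
    projectiveDimension (ModuleCat.of (TransfAlg n) (TrivialModule n)) = ((n - 1 : ℕ) : ℕ∞) := by
  -- With r = k + 1, the truncated difference r - 1 reduces to k.
  obtain ⟨k, rfl⟩ := Nat.exists_eq_add_of_le' hr
  have : NeZero n := ⟨by omega⟩
  refine ⟨isSimpleModule_extPow_aug hrn, ⟨linearIndependent_w, span_range_w⟩,
    ⟨fun q => diff n (k + 1 + q), augDiff n k, fun q i hi => diff_wedge_w i hi,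
      fun i hi => augDiff_wedge_w i hi, fun q hq => ?_, isMinimalProjectiveResolution_diff n k⟩,
    projectiveDimension_augObj hrn, ?_⟩
  · exact subsingleton_exteriorPower (n := n) (m := k + 1 + q) (by omega)
  · rw [← projectiveDimension_eq_of_linearEquiv (A := TransfAlg n) (L := ExtPow (augRep n) 0)
      (M := TrivialModule n) (extPowZeroEquiv n)]
    exact projectiveDimension_augObj (by omega)
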